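/- **Setting.** A BB84-type protocol family $\Pi=(\Pi_n)_{n\in\mathbb N}$ is a two-party protocol between Alice (classical input $u\in U_n$, output in $X_n$) and Bob (classical input in $V_n$, output in $Y_n$; all alphabets finite). In $\Pi_n$ a common reference string (possibly trivial) is drawn first. *Preparation:* Alice chooses uniform $x\in\{0,1\}^n$, $\theta\in\{+,\times\}^n$ and sends the $n$ qubits $|x\rangle_\theta$; honest Bob measures them in a uniform basis $\hat\theta\in\{+,\times\}^n$ with result $\hat x$. *Post-processing:* finitely many rounds $k=0,1,\dots$ of classical communication (in each round a message of Bob, then a reply of Alice; messages may be trivial) and arbitrary randomised local computation. Either player may abort instead of sending a message; Alice's output then follows a prescribed rule that depends only on her input. A dishonest Bob ${\sf B}'$ has a classical input $Z$ and a quantum input $V'$, gets the reference string, applies arbitrary quantum operations between the messages, and outputs a finite-dimensional quantum register $Y'$. An input state $\rho_{UZV'}$ with classical $U,Z$, chosen independently of the reference string, is *legitimate* if $\rho_{UZV'}=\rho_{U\leftrightarrow Z\leftrightarrow V'}$, i.e. given $Z$ the state of $V'$ does not depend on $U$. For a functionality $\mathcal F$ (conditional distributions $P_{\mathcal F(u,v)|uv}$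 on $X_n\times Y_n$), an ideal-world adversary $\hat{\sf B}'$ obtains from $Z,V'$ a classical input $v$ for $\mathcal F$, and from the reply and his remaining state he produces $Y'$; Alice forwards $u$ to $\mathcal F$ and outputs its reply. $\Pi$ implements $\mathcal F$ *unconditionally securely against a class of dishonest Bobs* if for every ${\sf B}'$ in the class there is an $\hat{\sf B}'$ such that for every (family of) legitimate input states the real joint output of Alice and ${\sf B}'$ and the ideal joint output of Alice and $\hat{\sf B}'$ have trace distance negligible in $n$. For a sequence $p$ of round numbers, *$\gamma$-BQSM Bobs (with the storage bound from round $p(n)$ on)* are those who, whenever they wait for Alice's reply of a round $k\ge p(n)$, store a quantum state on at most $\gamma n$ qubits, $n$ being the number of transmitted qubits; their classical memory, their quantum memory before that point, and the local operations are not restricted. ($p(n)=0$: the bound holds from the end of the preparation phase on.) **Compiler.** Let $0<\alpha<1$ and let a keyed classical commitment scheme be given for every $m$: a finite set of public keys with a key distribution, randomness with a distribution, and a function ${\tt Commit}_{\tt pk}(a,r)$ (no hiding or binding property is needed, so any dual-mode scheme is covered). The compiled protocol $\mathcal C^\alpha(\Pi)$ is indexed by the number $m$ of transmitted qubits; put $n=m-\lfloor\alpha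 m\rfloor$ (so $n=(1-\alpha)m$ if $\alpha m$ is an integer). Its reference string consists of that of $\Pi_n$ and an independent key ${\tt pk}$. Preparation is as above with $m$ qubits. Then Bob commits position-wise, $c_i={\tt Commit}_{\tt pk}((\hat\theta_i,\hat x_i),r_i)$; Alice replies by a uniformly random $T\subset\{1,\dots,m\}$ with $|T|=\lfloor\alpha m\rfloor$; Bob opens $c_i$ for $i\in T$; Alice aborts unless all these openings are correct and $x_i=\hat x_i$ for all $i\in T$ with $\theta_i=\hat\theta_i$. The positions in $T$ are discarded and the post-processing of $\Pi_n$ is executed on the strings restricted to the other $n$ positions; thus round $k$ of $\Pi_n$ becomes round $k+2$ of the compiled protocol, which is to implement $\mathcal F_n$. **Theorem.** Let $0<\alpha<1$ and $0<\gamma<1$, and let $p$ be any sequence of round numbers. If $\Pi$ implements $\mathcal F$ unconditionally securely against $\gamma$-BQSM Bob with the storage bound from round $p(n)$ on, then $\mathcal C^\alpha(\Pi)$ implements $\mathcal F$ unconditionally securely against $\gamma(1-\alpha)$-BQSM Bob with the storage bound from the corresponding round $p(n)+2$ on: that is, against every dishonest Bob who from there on stores at most $\gamma(1-\alpha)m$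 qubits, where $m$ is the number of qubits transmitted in $\mathcal C^\alpha(\Pi)$ and $n=m-\lfloor\alpha m\rfloor$. -/

import Mathlib

namespace BQSM

open scoped Kronecker ComplexOrder

/-! ### Quantum states and operations on finite-dimensional registers

A register is a finite type `D` of basis labels, standing for the Hilbert space with
orthonormal basis indexed by `D`; operators on it are matrices over `ℂ`. -/

/-- Density operators: positive semidefinite of trace one. -/
def IsDensity {D : Type} [Fintype D] (ρ : Matrix D D ℂ) : Prop :=
  ρ.PosSemidef ∧ ρ.trace = 1

open scoped MatrixOrder Matrix.Norms.L2Operator in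
/-- The trace norm `tr |A|`, where `|A| = √(A A†)`. -/
noncomputable def traceNorm {D : Type} [Fintype D] [DecidableEq D] (A : Matrix D D ℂ) : ℝ :=
  (CFC.sqrt (A * A.conjTranspose)).trace.re

/-- The trace distance `½ tr |ρ - σ|`. -/
noncomputable def traceDist {D : Type} [Fintype D] [DecidableEq D] (ρ σ : Matrix D D ℂ) : ℝ :=
  1 / 2 * traceNorm (ρ - σ)

/-- Trace distance of two states with a classical register `X` and a quantum register `D`.
Such a state `∑ₓ |x⟩⟨x| ⊗ ρₓ` is represented by its (subnormalised) blocks `ρₓ`. -/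
noncomputable def cqTraceDist {X D : Type} [Fintype X] [DecidableEq X] [Fintype D]
    [DecidableEq D] (ρ σ : X → Matrix D D ℂ) : ℝ :=
  traceDist (Matrix.blockDiagonal ρ) (Matrix.blockDiagonal σ)

/-- Negligible functions of the security parameter. -/
def Negligible (f : ℕ → ℝ) : Prop :=
  Asymptotics.SuperpolynomialDecay Filter.atTop (fun n : ℕ => (n : ℝ)) f

/-- A quantum instrument from register `D` to register `D'` with classical outcome in `O`,
given by Kraus operators. -/
structure Instrument (D O D' : Type) [Fintype D] [DecidableEq D] [Fintype O] [Fintype D'] where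
  κ : Type
  [fintypeκ : Fintype κ]
  op : O → κ → Matrix D' D ℂ
  complete : ∑ o, ∑ i, (op o i).conjTranspose * op o i = 1

attribute [instance] Instrument.fintypeκ

/-- The unnormalised state after `E` has been applied to `ρ` with outcome `o`. -/
noncomputable def Instrument.apply {D O D' : Type} [Fintype D] [DecidableEq D] [Fintype O]
    [Fintype D'] (E : Instrument D O D') (o : O) (ρ : Matrix D D ℂ) : Matrix D' D' ℂ :=
  ∑ i, E.op o i * ρ * (E.op o i).conjTranspose

/-- A quantum channel (an instrument without classical outcome). -/
abbrev Channel (D D' : Type) [Fintype D] [DecidableEq D] [Fintype D'] : Type 1 :=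
  Instrument D Unit D'

/-- A move of a quantum player holding register `D`: an instrument in which he either goes on,
with a classical outcome in `O` and remaining register `Q`, or else aborts and ends with
register `Y`. -/
structure Move (D O Q Y : Type) [Fintype D] [DecidableEq D] [Fintype O] [Fintype Q]
    [Fintype Y] where
  κ : Type
  [fintypeκ : Fintype κ]
  send : O → κ → Matrix Q D ℂ
  abort : κ → Matrix Y D ℂ
  complete : ∑ i, (abort i).conjTranspose * abort i
    + ∑ o, ∑ i, (send o i).conjTranspose * send o i = 1

attribute [instance] Move.fintypeκ

/-- The unnormalised state if the move does not abort and has outcome `o`. -/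
noncomputable def Move.applySend {D O Q Y : Type} [Fintype D] [DecidableEq D] [Fintype O]
    [Fintype Q] [Fintype Y] (E : Move D O Q Y) (o : O) (ρ : Matrix D D ℂ) : Matrix Q Q ℂ :=
  ∑ i, E.send o i * ρ * (E.send o i).conjTranspose

/-- The unnormalised state if the move aborts. -/
noncomputable def Move.applyAbort {D O Q Y : Type} [Fintype D] [DecidableEq D] [Fintype O]
    [Fintype Q] [Fintype Y] (E : Move D O Q Y) (ρ : Matrix D D ℂ) : Matrix Y Y ℂ :=
  ∑ i, E.abort i * ρ * (E.abort i).conjTranspose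

/-! ### BB84 qubits -/

/-- Bit strings of length `n`; a string of bases has `false` for `+` and `true` for `×`. -/
abbrev Bits (n : ℕ) : Type := Fin n → Bool

/-- The amplitude `⟨y|x⟩_θ` of a single BB84 qubit. -/
noncomputable def qubitAmp (x θ y : Bool) : ℂ :=
  if θ then (if x && y then -1 else 1) / (Real.sqrt 2 : ℂ) else if x = y then 1 else 0

/-- The vector `|x⟩_θ = |x₁⟩_θ₁ ⊗ ⋯ ⊗ |xₙ⟩_θₙ` in the computational basis. -/
noncomputable def bb84Vec {n : ℕ} (x θ : Bits n) : Bits n → ℂ :=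
  fun y => ∏ i, qubitAmp (x i) (θ i) (y i)

/-- The density operator of `|x⟩_θ`. -/
noncomputable def bb84State {n : ℕ} (x θ : Bits n) : Matrix (Bits n) (Bits n) ℂ :=
  Matrix.vecMulVec (bb84Vec x θ) (star (bb84Vec x θ))

/-! ### Protocols -/

/-- A BB84-type two-party protocol in which Alice sends `n` BB84 qubits to Bob, with classical
inputs `U` (Alice), `V` (Bob) and classical outputs `X` (Alice), `Y` (Bob).

*Set-up.* A common reference string in `Ω` is drawn from `crs` before the interaction starts
(`Ω` is a one-point type if the protocol uses none).

*Preparation.* Alice chooses uniform `x, θ` and sends `|x⟩_θ`. Honest Bob chooses a uniform `θ'`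
and measures in basis `θ'`, with result `x'`. This part is the same for all protocols, so only
its outcome occurs below.

*Post-processing.* Arbitrary classical communication in rounds `0, …, lastRound`. In round `k`
Bob sends a message in `MB k` and Alice replies by one in `MA k` (one-point types for
messages that are not needed); in between, each does arbitrary randomised local computations
with private states in `SA k`, `SB k`. Instead of sending a message either player may abort
(value `none`), which ends the execution; Alice then outputs according to `abortA` and Bob
according to `abortB`. -/
structure Protocol (n : ℕ) (U V X Y : Type) where
  Ω : Type
  [fintypeΩ : Fintype Ω]
  crs : PMF Ω
  lastRound : ℕ
  MB : ℕ → Type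
  MA : ℕ → Type
  [fintypeMB : ∀ k, Fintype (MB k)]
  [fintypeMA : ∀ k, Fintype (MA k)]
  /-- Alice's private state when she waits for Bob's message of round `k`. -/
  SA : ℕ → Type
  [fintypeSA : ∀ k, Fintype (SA k)]
  initA : Ω → U → (x θ : Bits n) → SA 0
  stepA : (k : ℕ) → SA k → MB k → PMF (Option (MA k × SA (k + 1)))
  /-- Alice's output; used for `k = lastRound + 1` only. -/
  outA : (k : ℕ) → SA k → PMF X
  abortA : U → PMF X
  /-- Honest Bob's private state when he waits for Alice's message of round `k`. -/
  SB : ℕ → Type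
  firstB : Ω → V → (θ' x' : Bits n) → PMF (Option (MB 0 × SB 0))
  nextB : (k : ℕ) → SB k → MA k → PMF (Option (MB (k + 1) × SB (k + 1)))
  /-- Honest Bob's output; used for `k = lastRound` only. -/
  outB : (k : ℕ) → SB k → MA k → PMF Y
  abortB : V → PMF Y

attribute [instance] Protocol.fintypeΩ Protocol.fintypeMB Protocol.fintypeMA Protocol.fintypeSA

/-- A classical non-reactive ideal functionality: the conditional distributions
`P_{F(u,v)|uv}`. -/
abbrev Functionality (U V X Y : Type) : Type := U → V → PMF (X × Y)

/-! ### Dishonest Bob -/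

/-- A (computationally unbounded) dishonest Bob against the protocol `P`. His input is a
classical `Z` and a quantum register `V'`; his output is a quantum register `Y'`. While waiting
for Alice's message of round `k` he stores a classical value in `C k` and the quantum register
`Q k`. Between the messages he applies arbitrary quantum operations. -/
structure RealAdversary {n : ℕ} {U V X Y : Type} (P : Protocol n U V X Y) where
  Z : Type
  V' : Type
  Y' : Type
  C : ℕ → Type
  Q : ℕ → Type
  [fintypeZ : Fintype Z]
  [nonemptyZ : Nonempty Z]
  [fintypeV' : Fintype V']
  [decidableEqV' : DecidableEq V']
  [nonemptyV' : Nonempty V']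
  [fintypeY' : Fintype Y']
  [decidableEqY' : DecidableEq Y']
  [fintypeC : ∀ k, Fintype (C k)]
  [fintypeQ : ∀ k, Fintype (Q k)]
  [decidableEqQ : ∀ k, DecidableEq (Q k)]
  /-- Given the reference string, his input and the `n` qubits sent by Alice, he chooses his
  first message. -/
  first : P.Ω → Z → Move (V' × Bits n) (P.MB 0 × C 0) (Q 0) Y'
  /-- Given Alice's message of round `k`, he chooses his message of round `k + 1`. -/
  next : (k : ℕ) → P.MA k → C k → Move (Q k) (P.MB (k + 1) × C (k + 1)) (Q (k + 1)) Y'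
  /-- His output after Alice's reply in round `k`, when this reply is the last one (`some a`)
  or when Alice aborts (`none`). -/
  output : (k : ℕ) → Option (P.MA k) → C k → Channel (Q k) Y'

attribute [instance] RealAdversary.fintypeZ RealAdversary.nonemptyZ RealAdversary.fintypeV'
  RealAdversary.decidableEqV' RealAdversary.nonemptyV' RealAdversary.fintypeY'
  RealAdversary.decidableEqY' RealAdversary.fintypeC RealAdversary.fintypeQ
  RealAdversary.decidableEqQ

/-- An ideal-world dishonest Bob: from `Z` and `V'` he produces a classical input to the
functionality, and from its reply and his remaining register `W` he produces `Y'`. -/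
structure IdealAdversary (V Y Z V' Y' : Type) [Fintype V] [Fintype V'] [DecidableEq V']
    [Fintype Y'] where
  W : Type
  [fintypeW : Fintype W]
  [decidableEqW : DecidableEq W]
  choose : Z → Instrument V' V W
  output : Z → V → Y → Channel W Y'

attribute [instance] IdealAdversary.fintypeW IdealAdversary.decidableEqW

/-- A joint input state `ρ_{UZV'} = ∑ P_{UZ}(u,z) |u⟩⟨u| ⊗ |z⟩⟨z| ⊗ ρ^{u,z}` with classical
`U`, `Z`. -/
structure InputState (U Z V' : Type) [Fintype V'] where
  prob : PMF (U × Z)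
  state : U → Z → Matrix V' V' ℂ
  isDensity : ∀ u z, IsDensity (state u z)

/-- `P_Z(z)` -/
noncomputable def InputState.probZ {U Z V' : Type} [Fintype U] [Fintype V']
    (I : InputState U Z V') (z : Z) : ℝ :=
  ∑ u, (I.prob (u, z)).toReal

/-- `ρ^z = ∑ᵤ P_{U|Z}(u|z) ρ^{u,z}` -/
noncomputable def InputState.avgState {U Z V' : Type} [Fintype U] [Fintype V']
    (I : InputState U Z V') (z : Z) : Matrix V' V' ℂ :=
  ∑ u, ((I.prob (u, z)).toReal / I.probZ z) • I.state u z

/-- Legitimate input states, `ρ_{UZV'} = ρ_{U ↔ Z ↔ V'}`, compared block by block. -/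
def InputState.IsLegitimate {U Z V' : Type} [Fintype U] [Fintype V']
    (I : InputState U Z V') : Prop :=
  ∀ u z, (I.prob (u, z)).toReal • I.state u z = (I.prob (u, z)).toReal • I.avgState z

/-! ### Real and ideal executions -/

/-- The execution of `P` between honest Alice with input `u` and state `s` and dishonest Bob,
from the moment when Bob has sent his message `b` of round `k` and holds `c` and the
(unnormalised) state `ρ`; `r` further rounds follow. The result is the (unnormalised) joint
output: for every output `o` of Alice, the block of Bob's register `Y'`. -/
noncomputable def interact {n : ℕ} {U V X Y : Type} {P : Protocol n U V X Y}
    (B : RealAdversary P) (u : U) : (r k : ℕ) → P.SA k → P.MB k → B.C k →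
      Matrix (B.Q k) (B.Q k) ℂ → X → Matrix B.Y' B.Y' ℂ
  | 0, k, s, b, c, ρ, o =>
      (P.stepA k s b none).toReal • (P.abortA u o).toReal • (B.output k none c).apply () ρ
      + ∑ p : P.MA k × P.SA (k + 1), (P.stepA k s b (some p)).toReal •
          (P.outA (k + 1) p.2 o).toReal • (B.output k (some p.1) c).apply () ρ
  | r + 1, k, s, b, c, ρ, o =>
      (P.stepA k s b none).toReal • (P.abortA u o).toReal • (B.output k none c).apply () ρ
      + ∑ p : P.MA k × P.SA (k + 1), (P.stepA k s b (some p)).toReal •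
          ((P.abortA u o).toReal • (B.next k p.1 c).applyAbort ρ
            + ∑ q : P.MB (k + 1) × B.C (k + 1),
                interact B u r (k + 1) p.2 q.1 q.2 ((B.next k p.1 c).applySend q ρ) o)

/-- The joint output of honest Alice and dishonest Bob on input `I`. -/
noncomputable def realOut {n : ℕ} {U V X Y : Type} [Fintype U] {P : Protocol n U V X Y}
    (B : RealAdversary P) (I : InputState U B.Z B.V') (o : X) : Matrix B.Y' B.Y' ℂ :=
  ∑ ω, (P.crs ω).toReal • ∑ i : U × B.Z, (I.prob i).toReal •
    ∑ x : Bits n, ∑ θ : Bits n, ((1 / 2 : ℝ) ^ n * (1 / 2 : ℝ) ^ n) •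
      ((P.abortA i.1 o).toReal •
          (B.first ω i.2).applyAbort (I.state i.1 i.2 ⊗ₖ bb84State x θ)
        + ∑ q : P.MB 0 × B.C 0,
            interact B i.1 P.lastRound 0 (P.initA ω i.1 x θ) q.1 q.2
              ((B.first ω i.2).applySend q (I.state i.1 i.2 ⊗ₖ bb84State x θ)) o)

/-- The joint output in the ideal world, where Alice forwards her input to `F` and outputs what
she obtains from `F`. -/
noncomputable def idealOut {U V X Y Z V' Y' : Type} [Fintype U] [Fintype V] [Fintype Y]
    [Fintype Z] [Fintype V'] [DecidableEq V'] [Fintype Y'] (F : Functionality U V X Y)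
    (S : IdealAdversary V Y Z V' Y') (I : InputState U Z V') (o : X) : Matrix Y' Y' ℂ :=
  ∑ i : U × Z, (I.prob i).toReal • ∑ v, ∑ y, (F i.1 v (o, y)).toReal •
    (S.output i.2 v y).apply () ((S.choose i.2).apply v (I.state i.1 i.2))

/-! ### Security against bounded-quantum-storage Bob -/

/-- The protocol family `P` implements `F` unconditionally securely against all dishonest Bobs
in the class `𝓑`: for every real-world adversary there is an ideal-world adversary such that,
for every legitimate input state, the real and the ideal joint output are statistically
indistinguishable. -/
def SecureAgainst {U V X Y : ℕ → Type} [∀ n, Fintype (U n)] [∀ n, Fintype (V n)]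
    [∀ n, Fintype (X n)] [∀ n, DecidableEq (X n)] [∀ n, Fintype (Y n)]
    (P : ∀ n, Protocol n (U n) (V n) (X n) (Y n)) (F : ∀ n, Functionality (U n) (V n) (X n) (Y n))
    (𝓑 : (∀ n, RealAdversary (P n)) → Prop) : Prop :=
  ∀ B : ∀ n, RealAdversary (P n), 𝓑 B →
    ∃ S : ∀ n, IdealAdversary (V n) (Y n) (B n).Z (B n).V' (B n).Y',
      ∀ I : ∀ n, InputState (U n) (B n).Z (B n).V', (∀ n, (I n).IsLegitimate) →
        Negligible fun n => cqTraceDist (realOut (B n) (I n)) (idealOut (F n) (S n) (I n))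

/-- Dishonest Bobs that store at most `γ n` qubits from round `p n` on, where `n` is the number
of qubits sent: whenever Bob waits for Alice's message of a round `k ≥ p n`, his quantum memory
fits into `q ≤ γ n` qubits. Classical memory is not restricted. With `p n = 0` the bound applies
from the end of the preparation phase. -/
def IsBoundedStorage {U V X Y : ℕ → Type} {P : ∀ n, Protocol n (U n) (V n) (X n) (Y n)}
    (γ : ℝ) (p : ℕ → ℕ) (B : ∀ n, RealAdversary (P n)) : Prop :=
  ∀ n k, p n ≤ k → k ≤ (P n).lastRound →
    ∃ q : ℕ, (q : ℝ) ≤ γ * n ∧ Fintype.card ((B n).Q k) ≤ 2 ^ q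

/-- Unconditional security against `γ`-BQSM Bob, the storage bound holding from round `p` on. -/
def BQSMSecure {U V X Y : ℕ → Type} [∀ n, Fintype (U n)] [∀ n, Fintype (V n)]
    [∀ n, Fintype (X n)] [∀ n, DecidableEq (X n)] [∀ n, Fintype (Y n)]
    (P : ∀ n, Protocol n (U n) (V n) (X n) (Y n)) (F : ∀ n, Functionality (U n) (V n) (X n) (Y n))
    (γ : ℝ) (p : ℕ → ℕ) : Prop :=
  SecureAgainst P F (IsBoundedStorage γ p)

/-! ### The compiler -/

/-- A keyed classical commitment scheme for pairs (basis, bit), with the distribution of the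
public key that is used as common reference string. A commitment `commit pk a r` is opened by
announcing `a` and `r`. No hiding or binding property is imposed, so dual-mode schemes with keys
of either mode are instances. -/
structure CommitmentScheme where
  PK : Type
  Com : Type
  Rnd : Type
  [fintypePK : Fintype PK]
  [fintypeCom : Fintype Com]
  [fintypeRnd : Fintype Rnd]
  keyGen : PMF PK
  randomness : PMF Rnd
  commit : PK → Bool × Bool → Rnd → Com

attribute [instance] CommitmentScheme.fintypePK CommitmentScheme.fintypeCom
  CommitmentScheme.fintypeRnd

/-- Independent samples from `p`, one for each position. -/
noncomputable def iidPMF {α : Type} (p : PMF α) : (m : ℕ) → PMF (Fin m → α)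
  | 0 => PMF.pure Fin.elim0
  | m + 1 => p.bind fun a => (iidPMF p m).map fun f => Fin.cons a f

/-- The test subsets `T`: subsets of the `m` positions that leave `n` positions over. -/
abbrev TestSet (n m : ℕ) : Type := {T : Finset (Fin m) // T.card = m - n}

instance (n m : ℕ) : Nonempty (TestSet n m) := by
  obtain ⟨T, -, hT⟩ := Finset.exists_subset_card_eq
    (s := (Finset.univ : Finset (Fin m))) (n := m - n) (by simp)
  exact ⟨⟨T, hT⟩⟩

/-- The increasing enumeration of the positions outside `T`. -/
def TestSet.rest {n m : ℕ} (h : n ≤ m) (T : TestSet n m) : Fin n ↪o Fin m :=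
  T.1ᶜ.orderEmbOfFin (by rw [Finset.card_compl, T.2, Fintype.card_fin]; omega)

/-- The restriction of a string to the positions outside `T`. -/
def TestSet.restrict {n m : ℕ} (h : n ≤ m) (T : TestSet n m) (x : Bits m) : Bits n :=
  fun i => x (T.rest h i)

/-- An opening of the commitments at some of the `m` positions: `some ((θ'ᵢ, x'ᵢ), rᵢ)` at a
position that is opened. -/
abbrev Opening (K : CommitmentScheme) (m : ℕ) : Type :=
  Fin m → Option ((Bool × Bool) × K.Rnd)

/-- Alice's test: every commitment in `T` is opened correctly, and `xᵢ = x'ᵢ` at all positions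
in `T` with `θᵢ = θ'ᵢ`. -/
def TestPassed {K : CommitmentScheme} {n m : ℕ} (pk : K.PK) (x θ : Bits m) (com : Fin m → K.Com)
    (T : TestSet n m) (d : Opening K m) : Prop :=
  ∀ i ∈ T.1, ∃ θ' x' r, d i = some ((θ', x'), r) ∧ com i = K.commit pk (θ', x') r ∧
    (θ i = θ' → x i = x')

open Classical in
/-- The compilation of a protocol `P` with `n` qubits into one with `m ≥ n` qubits. The reference
string additionally contains a public key. Rounds `0` and `1` are the verification phase:

* round `0`: Bob commits position-wise to his bases and results, Alice replies by a uniformly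
  random test subset `T` of size `m - n`;
* round `1`: Bob opens the commitments in `T`, Alice accepts, or rejects and aborts.

Then the positions in `T` are discarded, and the round `k` of `P` is carried out as round
`k + 2`, on the strings restricted to the positions outside `T`. -/
noncomputable def compile {n m : ℕ} (h : n ≤ m) {U V X Y : Type} [Fintype U]
    (P : Protocol n U V X Y) (K : CommitmentScheme) : Protocol m U V X Y where
  Ω := P.Ω × K.PK
  crs := P.crs.bind fun ω => K.keyGen.map fun pk => (ω, pk)
  lastRound := P.lastRound + 2
  MB
    | 0 => Fin m → K.Com
    | 1 => Opening K m
    | k + 2 => P.MB k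
  MA
    | 0 => TestSet n m
    | 1 => Unit
    | k + 2 => P.MA k
  fintypeMB
    | 0 => inferInstanceAs (Fintype (Fin m → K.Com))
    | 1 => inferInstanceAs (Fintype (Opening K m))
    | k + 2 => inferInstanceAs (Fintype (P.MB k))
  fintypeMA
    | 0 => inferInstanceAs (Fintype (TestSet n m))
    | 1 => inferInstanceAs (Fintype Unit)
    | k + 2 => inferInstanceAs (Fintype (P.MA k))
  SA
    | 0 => (P.Ω × K.PK) × U × Bits m × Bits m
    | 1 => ((P.Ω × K.PK) × U × Bits m × Bits m) × (Fin m → K.Com) × TestSet n m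
    | k + 2 => P.SA k
  fintypeSA
    | 0 => inferInstanceAs (Fintype ((P.Ω × K.PK) × U × Bits m × Bits m))
    | 1 => inferInstanceAs
        (Fintype (((P.Ω × K.PK) × U × Bits m × Bits m) × (Fin m → K.Com) × TestSet n m))
    | k + 2 => inferInstanceAs (Fintype (P.SA k))
  initA := fun ω u x θ => (ω, u, x, θ)
  stepA
    | 0 => fun s com =>
        (PMF.uniformOfFintype (TestSet n m)).map fun T => some (T, (s, com, T))
    | 1 => fun ⟨⟨⟨ω, pk⟩, u, x, θ⟩, com, T⟩ d =>
        PMF.pure (if TestPassed pk x θ com T d then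
          some ((), P.initA ω u (T.restrict h x) (T.restrict h θ)) else none)
    | k + 2 => fun s b => P.stepA k s b
  outA
    | 0 => fun s => P.abortA s.2.1
    | 1 => fun s => P.abortA s.1.2.1
    | k + 2 => fun s => P.outA k s
  abortA := P.abortA
  SB
    | 0 => (P.Ω × V × Bits m × Bits m) × (Fin m → K.Rnd)
    | 1 => (P.Ω × V × Bits m × Bits m) × TestSet n m
    | k + 2 => P.SB k
  firstB := fun ω v θ' x' => (iidPMF K.randomness m).map fun r =>
    some (fun i => K.commit ω.2 (θ' i, x' i) (r i), ((ω.1, v, θ', x'), r))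
  nextB
    | 0 => fun ⟨⟨ω, v, θ', x'⟩, r⟩ T =>
        PMF.pure (some (fun i => if i ∈ T.1 then some ((θ' i, x' i), r i) else none,
          ((ω, v, θ', x'), T)))
    | 1 => fun ⟨⟨ω, v, θ', x'⟩, T⟩ _ => P.firstB ω v (T.restrict h θ') (T.restrict h x')
    | k + 2 => fun s a => P.nextB k s a
  outB
    | 0 => fun s _ => P.abortB s.1.2.1
    | 1 => fun s _ => P.abortB s.1.2.1
    | k + 2 => fun s a => P.outB k s a
  abortB := P.abortB

/-- The number of positions that remain if `α m` of `m` positions are tested (the number of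
tested positions is rounded down to `⌊α m⌋`). -/
noncomputable def kept (α : ℝ) (m : ℕ) : ℕ := m - ⌊α * m⌋₊

theorem kept_le (α : ℝ) (m : ℕ) : kept α m ≤ m := Nat.sub_le _ _

/-- The compiled protocol `C^α(Π)`, a family indexed by the number `m` of transmitted qubits:
it tests `⌊α m⌋` positions and runs the post-processing of `Π` for `n = m - ⌊α m⌋` qubits. -/
noncomputable def compiled (α : ℝ) {U V X Y : ℕ → Type} [∀ n, Fintype (U n)]
    (P : ∀ n, Protocol n (U n) (V n) (X n) (Y n)) (K : ℕ → CommitmentScheme) (m : ℕ) :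
    Protocol m (U (kept α m)) (V (kept α m)) (X (kept α m)) (Y (kept α m)) :=
  compile (kept_le α m) (P (kept α m)) (K m)

end BQSM

/-! The verification phase gives a dishonest Bob nothing that he could not produce himself. Given a
Bob `B` against the compiled protocol, a Bob `simulate h B` against the original one receives `n`
qubits from Alice, samples a public key, a test set `T` and BB84 data `x', θ'` for the positions in
`T`, inserts the qubits `|x'⟩_θ'` at these positions and runs `B` on all `m` qubits. Alice's check
involves only the commitments, the openings and the strings at positions in `T`, so he can carry it
out himself. Where Alice would reject, he aborts; in both cases she outputs according to `abortA`.
Since `T` and the key are independent of everything else and the remaining `n` qubits are uniform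
BB84 states, the two executions have exactly the same joint output (`realOut_simulate`), whatever
the commitment scheme.

The whole verification phase is one local operation of the simulating Bob, before his first message.
Only from his round `k`, that is round `k + 2` of `B`, does his memory matter, and there it is that
of `B`. Since `(1 - α) m ≤ n`, a bound `γ (1 - α) m` implies the bound `γ n`. The ideal adversary
for the simulating Bob therefore serves `B` unchanged.

What remains is the change of index. Security of the original family concerns one adversary for each
`n`, but several `m` may leave the same `n`. Their number is bounded independently of `n`, so
finitely many families of adversaries reach every `m` (`exists_kept_sections`), and finitely many
negligible bounds in `n` give one in `m`, because `m ≤ n / (1 - α)` (`Negligible.of_kept`). -/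

namespace BQSM

open scoped Kronecker ComplexOrder

/-! ### Combinators for moves -/

namespace Move

section

variable {D O Q Y : Type} [Fintype D] [DecidableEq D] [Fintype O] [Fintype Q] [Fintype Y]

/-- The probabilistic mixture of a finite family of moves. -/
noncomputable def mix {ι : Type} [Fintype ι] (w : ι → ℝ) (hw : ∀ i, 0 ≤ w i) (hw1 : ∑ i, w i = 1)
    (M : ι → Move D O Q Y) : Move D O Q Y where
  -- The choice of `i` is part of the Kraus index, hence is forgotten; the weights enter by their
  -- square roots because Kraus operators act quadratically.
  κ := Σ i, (M i).κ
  send o j := (Real.sqrt (w j.1) : ℂ) • (M j.1).send o j.2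
  abort j := (Real.sqrt (w j.1) : ℂ) • (M j.1).abort j.2
  complete := by
    have hs : ∀ i, (Real.sqrt (w i) : ℂ) * star (Real.sqrt (w i) : ℂ) = (w i : ℂ) := fun i => by
      rw [Complex.star_def, Complex.conj_ofReal, ← Complex.ofReal_mul, Real.mul_self_sqrt (hw i)]
    simp only [Fintype.sum_sigma, Matrix.conjTranspose_smul, Matrix.smul_mul, Matrix.mul_smul,
      smul_smul, hs, ← Finset.smul_sum]
    rw [Finset.sum_comm, ← Finset.sum_add_distrib]
    simp only [← Finset.smul_sum, ← smul_add, (M _).complete]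
    rw [← Finset.sum_smul, ← Complex.ofReal_sum, hw1, Complex.ofReal_one, one_smul]

theorem sqrt_smul_conj {D E : Type} [Fintype D] {w : ℝ} (hw : 0 ≤ w) (A : Matrix E D ℂ)
    (ρ : Matrix D D ℂ) :
    ((Real.sqrt w : ℂ) • A) * ρ * ((Real.sqrt w : ℂ) • A).conjTranspose
      = w • (A * ρ * A.conjTranspose) := by
  rw [Matrix.conjTranspose_smul, Matrix.smul_mul, Matrix.smul_mul, Matrix.mul_smul, smul_smul,
    Complex.star_def, Complex.conj_ofReal, ← Complex.ofReal_mul, Real.mul_self_sqrt hw,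
    Complex.coe_smul]

theorem mix_applySend {ι : Type} [Fintype ι] (w : ι → ℝ) (hw : ∀ i, 0 ≤ w i)
    (hw1 : ∑ i, w i = 1) (M : ι → Move D O Q Y) (o : O) (ρ : Matrix D D ℂ) :
    (mix w hw hw1 M).applySend o ρ = ∑ i, w i • (M i).applySend o ρ := by
  simp only [applySend, Finset.smul_sum]
  refine (Fintype.sum_sigma _).trans (Finset.sum_congr rfl fun i _ =>
    Finset.sum_congr rfl fun j _ => sqrt_smul_conj (hw i) _ _)

theorem mix_applyAbort {ι : Type} [Fintype ι] (w : ι → ℝ) (hw : ∀ i, 0 ≤ w i)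
    (hw1 : ∑ i, w i = 1) (M : ι → Move D O Q Y) (ρ : Matrix D D ℂ) :
    (mix w hw hw1 M).applyAbort ρ = ∑ i, w i • (M i).applyAbort ρ := by
  simp only [applyAbort, Finset.smul_sum]
  refine (Fintype.sum_sigma _).trans (Finset.sum_congr rfl fun i _ =>
    Finset.sum_congr rfl fun j _ => sqrt_smul_conj (hw i) _ _)

/-- The move that first applies the isometry `W`. -/
def precomp {D' : Type} [Fintype D'] [DecidableEq D'] (M : Move D O Q Y) (W : Matrix D D' ℂ)
    (hW : W.conjTranspose * W = 1) : Move D' O Q Y where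
  κ := M.κ
  send o i := M.send o i * W
  abort i := M.abort i * W
  complete := by
    have h : ∀ {E : Type} [Fintype E] (A : Matrix E D ℂ),
        (A * W).conjTranspose * (A * W) = W.conjTranspose * (A.conjTranspose * A) * W := by
      intro E _ A
      simp only [Matrix.conjTranspose_mul, Matrix.mul_assoc]
    simp only [h, ← Matrix.mul_sum, ← Matrix.sum_mul]
    rw [← Matrix.add_mul, ← Matrix.mul_add, M.complete, Matrix.mul_one, hW]

theorem precomp_applySend {D' : Type} [Fintype D'] [DecidableEq D'] (M : Move D O Q Y)
    (W : Matrix D D' ℂ) (hW : W.conjTranspose * W = 1) (o : O) (ρ : Matrix D' D' ℂ) :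
    (M.precomp W hW).applySend o ρ = M.applySend o (W * ρ * W.conjTranspose) := by
  simp only [applySend, precomp, Matrix.conjTranspose_mul, Matrix.mul_assoc]
  rfl

theorem precomp_applyAbort {D' : Type} [Fintype D'] [DecidableEq D'] (M : Move D O Q Y)
    (W : Matrix D D' ℂ) (hW : W.conjTranspose * W = 1) (ρ : Matrix D' D' ℂ) :
    (M.precomp W hW).applyAbort ρ = M.applyAbort (W * ρ * W.conjTranspose) := by
  simp only [applyAbort, precomp, Matrix.conjTranspose_mul, Matrix.mul_assoc]
  rfl

/-- The move that always aborts, with output given by a channel. -/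
def ofChannel (O Q : Type) [Fintype O] [Fintype Q] (E : Channel D Y) : Move D O Q Y where
  κ := E.κ
  send _ _ := 0
  abort i := E.op () i
  complete := by simpa using E.complete

theorem ofChannel_applySend (E : Channel D Y) (o : O) (ρ : Matrix D D ℂ) :
    (ofChannel O Q E).applySend o ρ = 0 := by
  simp [applySend, ofChannel]

theorem ofChannel_applyAbort (E : Channel D Y) (ρ : Matrix D D ℂ) :
    (ofChannel O Q E).applyAbort ρ = E.apply () ρ := rfl

/-- Sequential composition: the second move depends on the outcome of the first. -/
def bind [DecidableEq Q] {O' Q' : Type} [Fintype O'] [Fintype Q'] (M : Move D O Q Y)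
    (N : O → Move Q O' Q' Y) : Move D O' Q' Y where
  -- The left summand accounts for an abort during `M`, after which nothing is sent; the
  -- intermediate outcome `o` is absorbed into the Kraus index.
  κ := M.κ ⊕ Σ o, M.κ × (N o).κ
  send o' := Sum.elim (fun _ => 0) fun j => (N j.1).send o' j.2.2 * M.send j.1 j.2.1
  abort := Sum.elim M.abort fun j => (N j.1).abort j.2.2 * M.send j.1 j.2.1
  complete := by
    have h : ∀ {E : Type} [Fintype E] (A : Matrix E Q ℂ) (W : Matrix Q D ℂ),
        (A * W).conjTranspose * (A * W) = W.conjTranspose * (A.conjTranspose * A) * W := by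
      intro E _ A W
      simp only [Matrix.conjTranspose_mul, Matrix.mul_assoc]
    simp only [Fintype.sum_sum_type, Fintype.sum_sigma, Sum.elim_inl, Sum.elim_inr, h,
      Fintype.sum_prod_type, ← Matrix.mul_sum, ← Matrix.sum_mul, Matrix.mul_zero,
      Finset.sum_const_zero, zero_add]
    rw [add_assoc, Finset.sum_comm (γ := O'), ← Finset.sum_add_distrib]
    rw [← M.complete]
    congr 1
    refine Finset.sum_congr rfl fun o _ => ?_
    rw [Finset.sum_comm (γ := O'), ← Finset.sum_add_distrib]
    refine Finset.sum_congr rfl fun i _ => ?_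
    rw [← Matrix.sum_mul, ← Matrix.mul_sum, ← Matrix.add_mul, ← Matrix.mul_add, (N o).complete,
      Matrix.mul_one]

theorem sum_conj_mul {D E F ι κ : Type} [Fintype D] [Fintype E] [Fintype ι] [Fintype κ]
    (A : ι → Matrix E D ℂ) (N : κ → Matrix F E ℂ) (ρ : Matrix D D ℂ) :
    ∑ p : ι × κ, N p.2 * A p.1 * ρ * (N p.2 * A p.1).conjTranspose
      = ∑ j, N j * (∑ i, A i * ρ * (A i).conjTranspose) * (N j).conjTranspose := by
  rw [Fintype.sum_prod_type_right]
  refine Finset.sum_congr rfl fun j _ => ?_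
  simp only [Matrix.mul_sum, Matrix.sum_mul, Matrix.conjTranspose_mul, Matrix.mul_assoc]

theorem bind_applySend [DecidableEq Q] {O' Q' : Type} [Fintype O'] [Fintype Q']
    (M : Move D O Q Y) (N : O → Move Q O' Q' Y) (o' : O') (ρ : Matrix D D ℂ) :
    (M.bind N).applySend o' ρ = ∑ o, (N o).applySend o' (M.applySend o ρ) := by
  refine (Fintype.sum_sum_type _).trans ?_
  simp only [bind, Sum.elim_inl, Sum.elim_inr, Matrix.zero_mul, Finset.sum_const_zero, zero_add]
  rw [Fintype.sum_sigma]
  exact Finset.sum_congr rfl fun o _ => sum_conj_mul (M.send o) ((N o).send o') ρ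

theorem bind_applyAbort [DecidableEq Q] {O' Q' : Type} [Fintype O'] [Fintype Q']
    (M : Move D O Q Y) (N : O → Move Q O' Q' Y) (ρ : Matrix D D ℂ) :
    (M.bind N).applyAbort ρ
      = M.applyAbort ρ + ∑ o, (N o).applyAbort (M.applySend o ρ) := by
  refine (Fintype.sum_sum_type _).trans ?_
  simp only [bind, Sum.elim_inl, Sum.elim_inr]
  rw [Fintype.sum_sigma]
  exact congrArg _ (Finset.sum_congr rfl fun o _ => sum_conj_mul (M.send o) (N o).abort ρ)

theorem isLinearMap_applySend (M : Move D O Q Y) (o : O) : IsLinearMap ℝ (M.applySend o) where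
  map_add ρ σ := by
    simp only [applySend, Matrix.mul_add, Matrix.add_mul, Finset.sum_add_distrib]
  map_smul a ρ := by
    simp only [applySend, Matrix.mul_smul, Matrix.smul_mul, Finset.smul_sum]

theorem isLinearMap_applyAbort (M : Move D O Q Y) : IsLinearMap ℝ M.applyAbort where
  map_add ρ σ := by
    simp only [applyAbort, Matrix.mul_add, Matrix.add_mul, Finset.sum_add_distrib]
  map_smul a ρ := by
    simp only [applyAbort, Matrix.mul_smul, Matrix.smul_mul, Finset.smul_sum]

end

end Move

theorem Instrument.isLinearMap_apply {D O D' : Type} [Fintype D] [DecidableEq D] [Fintype O]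
    [Fintype D'] (E : Instrument D O D') (o : O) : IsLinearMap ℝ (E.apply o) where
  map_add ρ σ := by
    simp only [Instrument.apply, Matrix.mul_add, Matrix.add_mul, Finset.sum_add_distrib]
  map_smul a ρ := by
    simp only [Instrument.apply, Matrix.mul_smul, Matrix.smul_mul, Finset.smul_sum]

/-! ### Linearity of the interaction in Bob's state -/

/-- Bob's operations are linear on unnormalised states and Alice's probabilities do not depend on
`ρ`. This allows Bob's mixtures and forgotten outcomes to be moved outside the rest of the
execution. -/
theorem isLinearMap_interact {n : ℕ} {U V X Y : Type} {P : Protocol n U V X Y}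
    (B : RealAdversary P) (u : U) (o : X) (r k : ℕ) (s : P.SA k) (b : P.MB k) (c : B.C k) :
    IsLinearMap ℝ fun ρ => interact B u r k s b c ρ o := by
  induction r generalizing k with
  | zero =>
    constructor
    · intro ρ σ
      simp only [interact, (Instrument.isLinearMap_apply _ _).map_add, smul_add,
        Finset.sum_add_distrib]
      abel
    · intro a ρ
      simp only [interact, (Instrument.isLinearMap_apply _ _).map_smul, smul_add, Finset.smul_sum,
        smul_comm a]
  | succ r ih =>
    constructor
    · intro ρ σ
      simp only [interact, (Instrument.isLinearMap_apply _ _).map_add,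
        (Move.isLinearMap_applyAbort _).map_add, (Move.isLinearMap_applySend _ _).map_add,
        (ih _ _ _ _).map_add, smul_add, Finset.sum_add_distrib]
      abel
    · intro a ρ
      simp only [interact, (Instrument.isLinearMap_apply _ _).map_smul,
        (Move.isLinearMap_applyAbort _).map_smul, (Move.isLinearMap_applySend _ _).map_smul,
        (ih _ _ _ _).map_smul, smul_add, Finset.smul_sum, smul_comm a]

theorem interact_zero {n : ℕ} {U V X Y : Type} {P : Protocol n U V X Y}
    (B : RealAdversary P) (u : U) (o : X) (r k : ℕ) (s : P.SA k) (b : P.MB k) (c : B.C k) :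
    interact B u r k s b c 0 o = 0 :=
  (isLinearMap_interact B u o r k s b c).map_zero

theorem interact_smul {n : ℕ} {U V X Y : Type} {P : Protocol n U V X Y}
    (B : RealAdversary P) (u : U) (o : X) (r k : ℕ) (s : P.SA k) (b : P.MB k) (c : B.C k) (a : ℝ)
    (ρ : Matrix (B.Q k) (B.Q k) ℂ) :
    interact B u r k s b c (a • ρ) o = a • interact B u r k s b c ρ o :=
  (isLinearMap_interact B u o r k s b c).map_smul a ρ

theorem interact_sum {n : ℕ} {U V X Y : Type} {P : Protocol n U V X Y}
    (B : RealAdversary P) (u : U) (o : X) (r k : ℕ) (s : P.SA k) (b : P.MB k) (c : B.C k)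
    {ι : Type} [Fintype ι] (ρ : ι → Matrix (B.Q k) (B.Q k) ℂ) :
    interact B u r k s b c (∑ i, ρ i) o = ∑ i, interact B u r k s b c (ρ i) o :=
  map_sum (isLinearMap_interact B u o r k s b c).mk' ρ Finset.univ

/-! ### Executions that start with a given move of Bob -/

/-- The joint output when Bob, holding the state `ρ`, makes the move `M` in order to choose his
message of round `k`, and `r` further rounds follow. -/
noncomputable def moveOut {n : ℕ} {U V X Y : Type} {P : Protocol n U V X Y}
    (B : RealAdversary P) (u : U) (o : X) (r k : ℕ) (s : P.SA k) {D : Type} [Fintype D]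
    [DecidableEq D] (M : Move D (P.MB k × B.C k) (B.Q k) B.Y') (ρ : Matrix D D ℂ) :
    Matrix B.Y' B.Y' ℂ :=
  (P.abortA u o).toReal • M.applyAbort ρ
    + ∑ q : P.MB k × B.C k, interact B u r k s q.1 q.2 (M.applySend q ρ) o

section moveOut

variable {n : ℕ} {U V X Y : Type} {P : Protocol n U V X Y} (B : RealAdversary P) (u : U) (o : X)
  (r k : ℕ) (s : P.SA k) {D : Type} [Fintype D] [DecidableEq D]

theorem moveOut_mix {ι : Type} [Fintype ι] (w : ι → ℝ) (hw : ∀ i, 0 ≤ w i) (hw1 : ∑ i, w i = 1)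
    (M : ι → Move D (P.MB k × B.C k) (B.Q k) B.Y') (ρ : Matrix D D ℂ) :
    moveOut B u o r k s (Move.mix w hw hw1 M) ρ = ∑ i, w i • moveOut B u o r k s (M i) ρ := by
  simp only [moveOut, Move.mix_applyAbort, Move.mix_applySend, interact_sum, interact_smul,
    smul_add, Finset.sum_add_distrib, Finset.smul_sum]
  rw [Finset.sum_comm (γ := ι)]
  simp only [smul_comm (w _)]

theorem moveOut_precomp {D' : Type} [Fintype D'] [DecidableEq D']
    (M : Move D (P.MB k × B.C k) (B.Q k) B.Y') (W : Matrix D D' ℂ)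
    (hW : W.conjTranspose * W = 1) (ρ : Matrix D' D' ℂ) :
    moveOut B u o r k s (M.precomp W hW) ρ
      = moveOut B u o r k s M (W * ρ * W.conjTranspose) := by
  simp only [moveOut, Move.precomp_applyAbort, Move.precomp_applySend]

theorem moveOut_ofChannel (E : Channel D B.Y') (ρ : Matrix D D ℂ) :
    moveOut B u o r k s (Move.ofChannel (P.MB k × B.C k) (B.Q k) E) ρ
      = (P.abortA u o).toReal • E.apply () ρ := by
  simp only [moveOut, Move.ofChannel_applyAbort, Move.ofChannel_applySend, interact_zero,
    Finset.sum_const_zero, add_zero]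

theorem moveOut_bind {O Q : Type} [Fintype O] [Fintype Q] [DecidableEq Q]
    (M : Move D O Q B.Y') (N : O → Move Q (P.MB k × B.C k) (B.Q k) B.Y') (ρ : Matrix D D ℂ) :
    moveOut B u o r k s (M.bind N) ρ = (P.abortA u o).toReal • M.applyAbort ρ
      + ∑ i, moveOut B u o r k s (N i) (M.applySend i ρ) := by
  simp only [moveOut, Move.bind_applyAbort, Move.bind_applySend, interact_sum, smul_add,
    Finset.smul_sum, Finset.sum_add_distrib]
  rw [Finset.sum_comm (γ := O), add_assoc]

end moveOut

/-! ### Splitting the qubits into tested and remaining ones -/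

section split

variable {n m : ℕ}

/-- The positions, split into those in `T` and those outside. -/
def TestSet.split (h : n ≤ m) (T : TestSet n m) : Fin (m - n) ⊕ Fin n ≃ Fin m :=
  finSumEquivOfFinset T.2 (by rw [Finset.card_compl, T.2, Fintype.card_fin]; omega)

theorem TestSet.split_inr (h : n ≤ m) (T : TestSet n m) (i : Fin n) :
    T.split h (Sum.inr i) = T.rest h i := by
  simp [split, rest]

theorem TestSet.exists_split_inl (h : n ≤ m) (T : TestSet n m) {i : Fin m} (hi : i ∈ T.1) :
    ∃ j, T.split h (Sum.inl j) = i := by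
  have : i ∈ Set.range (T.1.orderEmbOfFin T.2) := by rw [Finset.range_orderEmbOfFin]; exact hi
  obtain ⟨j, hj⟩ := this
  exact ⟨j, by simpa [split] using hj⟩

/-- Strings of length `m` as pairs of their restrictions outside `T` and to `T`. -/
def TestSet.merge (h : n ≤ m) (T : TestSet n m) : Bits n × Bits (m - n) ≃ Bits m :=
  (Equiv.prodComm _ _).trans
    ((Equiv.sumArrowEquivProdArrow _ _ _).symm.trans ((T.split h).arrowCongr (Equiv.refl Bool)))

theorem TestSet.merge_split_inl (h : n ≤ m) (T : TestSet n m) (p : Bits n × Bits (m - n))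
    (j : Fin (m - n)) : T.merge h p (T.split h (Sum.inl j)) = p.2 j := by
  simp [merge, Equiv.arrowCongr, Equiv.sumArrowEquivProdArrow]

theorem TestSet.merge_split_inr (h : n ≤ m) (T : TestSet n m) (p : Bits n × Bits (m - n))
    (j : Fin n) : T.merge h p (T.split h (Sum.inr j)) = p.1 j := by
  simp [merge, Equiv.arrowCongr, Equiv.sumArrowEquivProdArrow]

theorem TestSet.restrict_merge (h : n ≤ m) (T : TestSet n m) (p : Bits n × Bits (m - n)) :
    T.restrict h (T.merge h p) = p.1 := by
  funext i
  rw [restrict, ← split_inr, merge_split_inr]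

/-- The test looks only at positions in `T`, so it can be evaluated with arbitrary placeholders for
the strings that the simulator does not know. -/
theorem testPassed_merge {K : CommitmentScheme} (h : n ≤ m) (pk : K.PK) (T : TestSet n m)
    (x x₀ θ θ₀ : Bits n) (x' θ' : Bits (m - n)) (com : Fin m → K.Com) (d : Opening K m) :
    TestPassed pk (T.merge h (x, x')) (T.merge h (θ, θ')) com T d
      ↔ TestPassed pk (T.merge h (x₀, x')) (T.merge h (θ₀, θ')) com T d := by
  refine forall₂_congr fun i hi => ?_
  obtain ⟨j, rfl⟩ := T.exists_split_inl h hi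
  simp only [TestSet.merge_split_inl]

theorem bb84Vec_merge (h : n ≤ m) (T : TestSet n m) (x θ y : Bits n × Bits (m - n)) :
    bb84Vec (T.merge h x) (T.merge h θ) (T.merge h y)
      = bb84Vec x.1 θ.1 y.1 * bb84Vec x.2 θ.2 y.2 := by
  rw [bb84Vec, ← (T.split h).prod_comp, Fintype.prod_sum_type, mul_comm]
  simp only [TestSet.merge_split_inl, TestSet.merge_split_inr, bb84Vec]

theorem sum_star_mul_qubitAmp (x θ : Bool) :
    ∑ y, star (qubitAmp x θ y) * qubitAmp x θ y = 1 := by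
  have h2 : ((Real.sqrt 2 : ℝ) : ℂ) * (Real.sqrt 2 : ℝ) = 2 := by
    rw [← Complex.ofReal_mul, Real.mul_self_sqrt (by norm_num)]; norm_num
  have h0 : ((Real.sqrt 2 : ℝ) : ℂ) ≠ 0 := by
    intro h; rw [h] at h2; norm_num at h2
  cases x <;> cases θ <;> simp [qubitAmp] <;> field_simp <;> rw [sq, h2] <;> norm_num

theorem sum_star_mul_bb84Vec (x θ : Bits n) :
    ∑ y, star (bb84Vec x θ y) * bb84Vec x θ y = 1 := by
  simp only [bb84Vec, star_prod, ← Finset.prod_mul_distrib]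
  rw [← Fintype.prod_sum fun i y => star (qubitAmp (x i) (θ i) y) * qubitAmp (x i) (θ i) y]
  simp only [sum_star_mul_qubitAmp, Finset.prod_const_one]

/-- The isometry that inserts the qubits `|x'⟩_θ'` at the positions in `T`. -/
noncomputable def insertQubits (E : Type) [DecidableEq E] (h : n ≤ m) (T : TestSet n m)
    (x' θ' : Bits (m - n)) : Matrix (E × Bits m) (E × Bits n) ℂ :=
  fun a b => if a.1 = b.1 ∧ ((T.merge h).symm a.2).1 = b.2 then
    bb84Vec x' θ' ((T.merge h).symm a.2).2 else 0

theorem sum_merge {E : Type} [Fintype E] {M : Type} [AddCommMonoid M] (h : n ≤ m) (T : TestSet n m)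
    (f : E × Bits m → M) :
    ∑ a, f a = ∑ e, ∑ y, ∑ y', f (e, T.merge h (y, y')) := by
  rw [Fintype.sum_prod_type]
  refine Finset.sum_congr rfl fun e _ => ?_
  rw [← (T.merge h).sum_comp, Fintype.sum_prod_type]

variable {E : Type} [Fintype E] [DecidableEq E]

theorem insertQubits_isometry (h : n ≤ m) (T : TestSet n m) (x' θ' : Bits (m - n)) :
    (insertQubits E h T x' θ').conjTranspose * insertQubits E h T x' θ' = 1 := by
  ext ⟨a, y⟩ ⟨b, z⟩
  rw [Matrix.mul_apply, sum_merge h T]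
  simp only [Matrix.conjTranspose_apply, insertQubits, Equiv.symm_apply_apply, ite_and,
    apply_ite star, star_zero, ite_mul, mul_ite, zero_mul, mul_zero, Finset.sum_ite_irrel,
    Finset.sum_const_zero, Finset.sum_ite_eq', Finset.mem_univ, if_true, sum_star_mul_bb84Vec,
    Matrix.one_apply, Prod.mk.injEq, eq_comm (a := b), eq_comm (a := z)]

/-- BB84 states are product states, so inserting fresh qubits at the positions in `T` yields exactly
the state that Alice sends in the compiled protocol. -/
theorem insertQubits_conj (h : n ≤ m) (T : TestSet n m) (x θ : Bits n) (x' θ' : Bits (m - n))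
    (ρ : Matrix E E ℂ) :
    insertQubits E h T x' θ' * (ρ ⊗ₖ bb84State x θ) * (insertQubits E h T x' θ').conjTranspose
      = ρ ⊗ₖ bb84State (T.merge h (x, x')) (T.merge h (θ, θ')) := by
  ext ⟨a, y⟩ ⟨b, z⟩
  obtain ⟨⟨y, y'⟩, rfl⟩ := (T.merge h).surjective y
  obtain ⟨⟨z, z'⟩, rfl⟩ := (T.merge h).surjective z
  simp only [Matrix.mul_apply, Matrix.conjTranspose_apply, insertQubits, Equiv.symm_apply_apply,
    Fintype.sum_prod_type, ite_and, apply_ite star, star_zero, ite_mul, mul_ite, zero_mul,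
    mul_zero, Finset.sum_ite_irrel, Finset.sum_const_zero, Finset.sum_ite_eq, Finset.mem_univ,
    if_true, Matrix.kroneckerMap_apply, bb84State, Matrix.vecMulVec_apply, Pi.star_apply,
    bb84Vec_merge, star_mul']
  ring

end split

/-! ### Sums over discrete distributions -/

theorem sum_toReal_eq_one {A : Type} [Fintype A] (μ : PMF A) : ∑ a, (μ a).toReal = 1 := by
  rw [← ENNReal.toReal_sum fun a _ => μ.apply_ne_top a, ← tsum_fintype (L := .unconditional _),
    μ.tsum_coe,
    ENNReal.toReal_one]

theorem sum_map_toReal_smul {A B M : Type} [Fintype A] [Fintype B] [AddCommMonoid M] [Module ℝ M]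
    (μ : PMF A) (g : A → B) (f : B → M) :
    ∑ b, ((μ.map g) b).toReal • f b = ∑ a, (μ a).toReal • f (g a) := by
  classical
  have h : ∀ b, ((μ.map g) b).toReal = ∑ a, if b = g a then (μ a).toReal else 0 := fun b => by
    rw [PMF.map_apply, tsum_fintype, ENNReal.toReal_sum]
    · exact Finset.sum_congr rfl fun a _ => by split_ifs <;> simp
    · intro a _
      split_ifs
      · exact μ.apply_ne_top a
      · exact ENNReal.zero_ne_top
  simp only [h, Finset.sum_smul]
  rw [Finset.sum_comm]
  simp only [ite_smul, zero_smul, Finset.sum_ite_eq', Finset.mem_univ, if_true]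

theorem sum_pure_toReal_smul {B M : Type} [Fintype B] [AddCommMonoid M] [Module ℝ M]
    (b₀ : B) (f : B → M) : ∑ b, ((PMF.pure b₀) b).toReal • f b = f b₀ := by
  classical
  simp [PMF.pure_apply, apply_ite ENNReal.toReal, ite_smul]

/-- The term `c` will be Bob's abort before `T` is drawn: independent of `T`, it can be averaged
over `T` at no cost. -/
theorem add_sum_sum_smul {A B M : Type} [Fintype A] [Fintype B] [AddCommMonoid M] [Module ℝ M]
    {w : A → ℝ} (hw : ∑ a, w a = 1) (c : M) (f : A → B → M) :
    c + ∑ b, ∑ a, w a • f a b = ∑ a, w a • (c + ∑ b, f a b) := by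
  simp only [smul_add, Finset.sum_add_distrib, ← Finset.sum_smul, hw, one_smul, Finset.smul_sum]
  rw [Finset.sum_comm]

theorem bind_map_mk_toReal {A B : Type} [Fintype A] [Fintype B] (μ : PMF A) (ν : PMF B)
    (a : A) (b : B) :
    ((μ.bind fun a => ν.map fun b => (a, b)) (a, b)).toReal = (μ a).toReal * (ν b).toReal := by
  classical
  simp [PMF.bind_apply, PMF.map_apply, tsum_fintype, Prod.ext_iff, ite_and]

/-- For fixed `T`, `T.merge h` is a bijection. Once the sum over `T` is outermost, the strings can
be reindexed with a splitting that depends on `T`. -/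
theorem sum_bits_split {n m : ℕ} (h : n ≤ m) {M : Type} [AddCommMonoid M] [Module ℝ M]
    (a b : ℝ) (w : TestSet n m → ℝ) (G : TestSet n m → Bits m → Bits m → M) :
    ∑ x, ∑ θ, (a * b) • ∑ T, w T • G T x θ
      = ∑ x : Bits n, ∑ θ : Bits n, a • ∑ T, ∑ x', ∑ θ',
          (w T * b) • G T (T.merge h (x, x')) (T.merge h (θ, θ')) := by
  have hl : ∑ x, ∑ θ, (a * b) • ∑ T, w T • G T x θ
      = ∑ T, ∑ x, ∑ θ, (a * (w T * b)) • G T x θ := by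
    simp only [Finset.smul_sum, smul_smul]
    rw [Finset.sum_comm (γ := TestSet n m)]
    refine Finset.sum_congr rfl fun x _ => ?_
    rw [Finset.sum_comm (γ := TestSet n m)]
    refine Finset.sum_congr rfl fun θ _ => Finset.sum_congr rfl fun T _ => ?_
    rw [mul_assoc, mul_comm b]
  have hr : ∑ x : Bits n, ∑ θ : Bits n, a • ∑ T, ∑ x', ∑ θ',
          (w T * b) • G T (T.merge h (x, x')) (T.merge h (θ, θ'))
      = ∑ T, ∑ x : Bits n, ∑ θ : Bits n, ∑ x', ∑ θ',
          (a * (w T * b)) • G T (T.merge h (x, x')) (T.merge h (θ, θ')) := by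
    simp only [Finset.smul_sum, smul_smul]
    rw [Finset.sum_comm (γ := TestSet n m)]
    refine Finset.sum_congr rfl fun x _ => ?_
    rw [Finset.sum_comm (γ := TestSet n m)]
  rw [hl, hr]
  refine Finset.sum_congr rfl fun T _ => ?_
  simp only [← (T.merge h).sum_comp, Fintype.sum_prod_type]
  refine Finset.sum_congr rfl fun x _ => ?_
  rw [Finset.sum_comm]

theorem sum_key_comm {A I B C M : Type} [Fintype A] [Fintype I] [Fintype B] [Fintype C]
    [AddCommMonoid M] [Module ℝ M] (w : A → ℝ) (p : I → ℝ) (c : ℝ) (G : A → I → B → C → M) :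
    ∑ i, p i • ∑ x, ∑ y, c • ∑ a, w a • G a i x y
      = ∑ a, w a • ∑ i, p i • ∑ x, ∑ y, c • G a i x y := by
  simp only [Finset.smul_sum]
  rw [Finset.sum_comm (γ := A)]
  refine Finset.sum_congr rfl fun i _ => ?_
  rw [Finset.sum_comm (γ := A)]
  refine Finset.sum_congr rfl fun x _ => ?_
  rw [Finset.sum_comm (γ := A)]
  refine Finset.sum_congr rfl fun y _ => Finset.sum_congr rfl fun a _ => ?_
  rw [smul_comm c, smul_comm (p i)]

/-! ### The simulation -/

section simulation

variable {n m : ℕ} (h : n ≤ m) {U V X Y : Type} [Fintype U] {P : Protocol n U V X Y}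
  {K : CommitmentScheme} (B : RealAdversary (compile h P K))

open Classical in
/-- What Bob does up to his first message of the post-processing, if Alice tests the positions
in `T` and accepts under the condition `ok`; if she rejects, this counts as an abort of Bob. -/
noncomputable def verificationMove (ω : P.Ω × K.PK) (z : B.Z) (T : TestSet n m)
    (ok : (Fin m → K.Com) → Opening K m → Prop) :
    Move (B.V' × Bits m) (P.MB 0 × B.C 2) (B.Q 2) B.Y' :=
  (B.first ω z).bind fun q => (B.next 0 T q.2).bind fun q' =>
    if ok q.1 q'.1 then B.next 1 () q'.2
    else Move.ofChannel _ _ (B.output 1 none q'.2)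

/-- The distribution of the data that the simulator has to sample himself. -/
noncomputable def simWeight (n m : ℕ) (K : CommitmentScheme)
    (j : K.PK × TestSet n m × Bits (m - n) × Bits (m - n)) : ℝ :=
  (K.keyGen j.1).toReal * ((PMF.uniformOfFintype (TestSet n m) j.2.1).toReal *
    ((1 / 2 : ℝ) ^ (m - n) * (1 / 2 : ℝ) ^ (m - n)))

theorem simWeight_nonneg (j : K.PK × TestSet n m × Bits (m - n) × Bits (m - n)) :
    0 ≤ simWeight n m K j := by
  unfold simWeight; positivity

theorem sum_simWeight : ∑ j, simWeight n m K j = 1 := by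
  have h1 : ∑ _ : Bits (m - n), (1 / 2 : ℝ) ^ (m - n) = 1 := by
    simp
  have h2 : (1 / 2 : ℝ) ^ (m - n) * ∑ _ : Bits (m - n), 1 = 1 := by
    simp
  simp only [simWeight, Fintype.sum_prod_type, ← Finset.mul_sum, h1, h2, mul_one,
    sum_toReal_eq_one]

/-- The adversary against `P` that carries out the verification phase of the compiled protocol in
his head, with self-made tested qubits, and then behaves like the adversary `B` against the
compiled protocol. -/
noncomputable def simulate : RealAdversary P where
  Z := B.Z
  V' := B.V'
  Y' := B.Y'
  C k := B.C (k + 2)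
  Q k := B.Q (k + 2)
  -- The constant `false` stands for Alice's unknown bits and bases outside `T`; `testPassed_merge`
  -- makes it harmless.
  first ω z := Move.mix (simWeight n m K) simWeight_nonneg sum_simWeight fun j =>
    (verificationMove h B (ω, j.1) z j.2.1 fun com => TestPassed j.1
      (j.2.1.merge h (fun _ => false, j.2.2.1)) (j.2.1.merge h (fun _ => false, j.2.2.2)) com
      j.2.1).precomp
        (insertQubits B.V' h j.2.1 j.2.2.1 j.2.2.2) (insertQubits_isometry h _ _ _)
  next k a c := B.next (k + 2) a c
  output k a c := B.output (k + 2) a c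

/-- From round 2 on, the data of the compiled protocol and of `B` are those of `P` and `simulate h
B` with the index shifted, so the two recursions unfold to the same terms. -/
theorem interact_simulate (u : U) (o : X) (r k : ℕ) (s : P.SA k) (b : P.MB k) (c : B.C (k + 2))
    (ρ : Matrix (B.Q (k + 2)) (B.Q (k + 2)) ℂ) :
    interact (simulate h B) u r k s b c ρ o
      = interact B u r (k + 2) (show (compile h P K).SA (k + 2) from s)
          (show (compile h P K).MB (k + 2) from b) c ρ o := by
  induction r generalizing k with
  | zero => rfl
  | succ r ih =>
    simp only [interact]
    refine congrArg₂ _ rfl (Finset.sum_congr rfl fun p _ => congrArg₂ _ rfl (congrArg₂ _ rfl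
      (Finset.sum_congr rfl fun q _ => ih (k + 1) p.2 q.1 q.2 _)))

/-- Alice never aborts in round `0`. Combining the cases `none` and `some` into one sum over
`Option` turns the claim into an expectation under the image of the uniform distribution. -/
theorem interact_commit (u : U) (o : X) (s : (compile h P K).SA 0) (com : Fin m → K.Com)
    (c : B.C 0) (ρ : Matrix (B.Q 0) (B.Q 0) ℂ) :
    interact B u (P.lastRound + 2) 0 s com c ρ o
      = ∑ T : TestSet n m, (PMF.uniformOfFintype (TestSet n m) T).toReal •
          ((P.abortA u o).toReal • (B.next 0 T c).applyAbort ρ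
            + ∑ q : Opening K m × B.C 1, interact B u (P.lastRound + 1) 1 (s, com, T) q.1 q.2
                ((B.next 0 T c).applySend q ρ) o) :=
  (Fintype.sum_option fun a => (((compile h P K).stepA 0 s com) a).toReal •
    a.elim ((P.abortA u o).toReal • (B.output 0 none c).apply () ρ) fun p =>
      (P.abortA u o).toReal • (B.next 0 p.1 c).applyAbort ρ
        + ∑ q : Opening K m × B.C 1, interact B u (P.lastRound + 1) 1 p.2 q.1 q.2
            ((B.next 0 p.1 c).applySend q ρ) o).symm.trans (sum_map_toReal_smul _ _ _)

open Classical in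
-- Alice's rejection may be charged to Bob: either way she outputs by `abortA`, and `Move.ofChannel`
-- lets Bob end with the output he gives upon rejection.
theorem interact_open (u : U) (o : X) (ω : P.Ω × K.PK) (x θ : Bits m) (com : Fin m → K.Com)
    (T : TestSet n m) (d : Opening K m) (c : B.C 1) (ρ : Matrix (B.Q 1) (B.Q 1) ℂ) :
    interact B u (P.lastRound + 1) 1 ((ω, u, x, θ), com, T) d c ρ o
      = moveOut (simulate h B) u o P.lastRound 0
          (P.initA ω.1 u (T.restrict h x) (T.restrict h θ))
          (if TestPassed ω.2 x θ com T d then B.next 1 () c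
            else Move.ofChannel _ _ (B.output 1 none c)) ρ := by
  refine (Fintype.sum_option fun a => (((compile h P K).stepA 1 ((ω, u, x, θ), com, T) d)
    a).toReal • a.elim ((P.abortA u o).toReal • (B.output 1 none c).apply () ρ) fun p =>
      (P.abortA u o).toReal • (B.next 1 p.1 c).applyAbort ρ
        + ∑ q : P.MB 0 × B.C 2, interact B u P.lastRound 2 p.2 q.1 q.2
            ((B.next 1 p.1 c).applySend q ρ) o).symm.trans ((sum_pure_toReal_smul _ _).trans ?_)
  by_cases ht : TestPassed ω.2 x θ com T d
  · refine (congrArg (Option.elim · _ _) (if_pos ht)).trans (Eq.trans ?_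
      (congrArg (moveOut (simulate h B) u o P.lastRound 0 _ · ρ) (if_pos ht).symm))
    exact congrArg₂ (· + ·) rfl (Finset.sum_congr rfl fun (q : P.MB 0 × B.C 2) _ =>
      (interact_simulate h B u o P.lastRound 0 _ q.1 q.2 _).symm)
  · refine (congrArg (Option.elim · _ _) (if_neg ht)).trans (Eq.trans ?_
      (congrArg (moveOut (simulate h B) u o P.lastRound 0 _ · ρ) (if_neg ht).symm))
    exact (moveOut_ofChannel (simulate h B) u o P.lastRound 0 _ _ ρ).symm

theorem moveOut_first (u : U) (o : X) (ω : P.Ω × K.PK) (z : B.Z) (x θ : Bits m)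
    (ρ : Matrix (B.V' × Bits m) (B.V' × Bits m) ℂ) :
    moveOut B u o (P.lastRound + 2) 0 ((compile h P K).initA ω u x θ) (B.first ω z) ρ
      = ∑ T, (PMF.uniformOfFintype (TestSet n m) T).toReal •
          moveOut (simulate h B) u o P.lastRound 0
            (P.initA ω.1 u (T.restrict h x) (T.restrict h θ))
            (verificationMove h B ω z T fun com => TestPassed ω.2 x θ com T) ρ := by
  have hv : ∀ T : TestSet n m, moveOut (simulate h B) u o P.lastRound 0
      (P.initA ω.1 u (T.restrict h x) (T.restrict h θ))
      (verificationMove h B ω z T fun com => TestPassed ω.2 x θ com T) ρ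
      = (P.abortA u o).toReal • (B.first ω z).applyAbort ρ
        + ∑ q : (Fin m → K.Com) × B.C 0,
          ((P.abortA u o).toReal • (B.next 0 T q.2).applyAbort ((B.first ω z).applySend q ρ)
            + ∑ q' : Opening K m × B.C 1,
              interact B u (P.lastRound + 1) 1 ((ω, u, x, θ), q.1, T) q'.1 q'.2
                ((B.next 0 T q.2).applySend q' ((B.first ω z).applySend q ρ)) o) := by
    intro T
    refine (moveOut_bind (simulate h B) u o P.lastRound 0 _ _ _ ρ).trans
      (congrArg₂ _ rfl (Finset.sum_congr rfl fun q _ => ?_))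
    refine (moveOut_bind (simulate h B) u o P.lastRound 0 _ _ _ _).trans
      (congrArg₂ _ rfl (Finset.sum_congr rfl fun q' _ => ?_))
    exact (interact_open h B u o ω x θ q.1 T q'.1 q'.2 _).symm
  refine Eq.trans ?_ (Finset.sum_congr rfl fun T _ => congrArg _ (hv T).symm)
  refine Eq.trans (congrArg₂ (· + ·) rfl (Finset.sum_congr rfl
    fun (q : (Fin m → K.Com) × B.C 0) _ =>
    interact_commit h B u o (ω, u, x, θ) q.1 q.2 _)) ?_
  -- Bob makes his first move before `T` is drawn, whereas in `verificationMove` the set `T` is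
  -- fixed beforehand; the orders can be exchanged because `T` does not depend on his move.
  exact add_sum_sum_smul (sum_toReal_eq_one _) _ _

/-- The simulation is perfect: after splitting Alice's strings along `T`, both sides are the same
average over the reference string, the input, Alice's data outside `T`, and the data weighted by
`simWeight`. -/
theorem realOut_simulate (I : InputState U B.Z B.V') (o : X) :
    realOut (simulate h B) I o = realOut B I o := by
  have hpow : ((1 / 2 : ℝ) ^ m * (1 / 2 : ℝ) ^ m)
      = ((1 / 2 : ℝ) ^ n * (1 / 2 : ℝ) ^ n) * ((1 / 2 : ℝ) ^ (m - n) * (1 / 2 : ℝ) ^ (m - n)) := by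
    obtain ⟨k, rfl⟩ := Nat.exists_eq_add_of_le h
    rw [Nat.add_sub_cancel_left]; ring
  have hsim : ∀ (ω : P.Ω) (i : U × B.Z) (x θ : Bits n),
      (P.abortA i.1 o).toReal • ((simulate h B).first ω i.2).applyAbort
          (I.state i.1 i.2 ⊗ₖ bb84State x θ)
        + ∑ q : P.MB 0 × (simulate h B).C 0, interact (simulate h B) i.1 P.lastRound 0
            (P.initA ω i.1 x θ) q.1 q.2
            (((simulate h B).first ω i.2).applySend q (I.state i.1 i.2 ⊗ₖ bb84State x θ)) o
      = ∑ j, simWeight n m K j • moveOut (simulate h B) i.1 o P.lastRound 0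
          (P.initA ω i.1 x θ)
          (verificationMove h B (ω, j.1) i.2 j.2.1 fun com => TestPassed j.1
            (j.2.1.merge h (x, j.2.2.1)) (j.2.1.merge h (θ, j.2.2.2)) com j.2.1)
          (I.state i.1 i.2 ⊗ₖ bb84State (j.2.1.merge h (x, j.2.2.1))
            (j.2.1.merge h (θ, j.2.2.2))) := by
    intro ω i x θ
    refine (moveOut_mix (simulate h B) i.1 o P.lastRound 0 (P.initA ω i.1 x θ) _
      simWeight_nonneg sum_simWeight _ _).trans
      (Finset.sum_congr rfl fun j _ => congrArg _ ?_)
    refine (moveOut_precomp (simulate h B) i.1 o P.lastRound 0 _ _ _ _ _).trans ?_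
    refine congrArg₂ _ ?_ (insertQubits_conj h _ _ _ _ _ _)
    -- Here the placeholders in the simulator's test are replaced by Alice's actual strings.
    refine congrArg _ (funext fun com => funext fun d => propext ?_)
    exact testPassed_merge h _ _ _ _ _ _ _ _ _ _
  have hreal : ∀ (ω : P.Ω) (pk : K.PK) (i : U × B.Z),
      ∑ x : Bits m, ∑ θ : Bits m, ((1 / 2 : ℝ) ^ m * (1 / 2 : ℝ) ^ m) •
        moveOut B i.1 o (P.lastRound + 2) 0 ((compile h P K).initA (ω, pk) i.1 x θ)
          (B.first (ω, pk) i.2) (I.state i.1 i.2 ⊗ₖ bb84State x θ)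
      = ∑ x : Bits n, ∑ θ : Bits n, ((1 / 2 : ℝ) ^ n * (1 / 2 : ℝ) ^ n) •
        ∑ T, ∑ x', ∑ θ', ((PMF.uniformOfFintype (TestSet n m) T).toReal *
          ((1 / 2 : ℝ) ^ (m - n) * (1 / 2 : ℝ) ^ (m - n))) •
          moveOut (simulate h B) i.1 o P.lastRound 0 (P.initA ω i.1 x θ)
          (verificationMove h B (ω, pk) i.2 T fun com => TestPassed pk
            (T.merge h (x, x')) (T.merge h (θ, θ')) com T)
          (I.state i.1 i.2 ⊗ₖ bb84State (T.merge h (x, x')) (T.merge h (θ, θ'))) := by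
    intro ω pk i
    refine (Finset.sum_congr rfl fun x _ => Finset.sum_congr rfl fun θ _ =>
      congrArg₂ (· • ·) hpow (moveOut_first h B i.1 o (ω, pk) i.2 x θ _)).trans ?_
    refine (sum_bits_split h _ _ _ _).trans ?_
    simp only [TestSet.restrict_merge]
    rfl
  have hcrs : ∀ (ω : P.Ω) (pk : K.PK), ((compile h P K).crs (ω, pk)).toReal
      = (P.crs ω).toReal * (K.keyGen pk).toReal := bind_map_mk_toReal P.crs K.keyGen
  refine Eq.trans ?_ (Fintype.sum_prod_type _).symm
  refine Finset.sum_congr rfl fun ω _ => ?_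
  refine Eq.trans ?_ (Finset.sum_congr rfl fun pk _ => congrArg₂ (· • ·) (hcrs ω pk).symm
    (Finset.sum_congr rfl fun (i : U × B.Z) _ => congrArg _ (hreal ω pk i).symm))
  -- The key is drawn before the execution on one side and by Bob on the other; its independence
  -- allows its sum to be moved inside.
  refine Eq.trans (congrArg _ (Eq.trans ?_ (sum_key_comm (fun pk => (K.keyGen pk).toReal) _ _ _)))
    (Finset.smul_sum.trans (Finset.sum_congr rfl fun pk _ => smul_smul _ _ _))
  refine Finset.sum_congr rfl fun i _ => congrArg _ (Finset.sum_congr rfl fun x _ =>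
    Finset.sum_congr rfl fun θ _ => congrArg _ ((hsim ω i x θ).trans ?_))
  simp only [Fintype.sum_prod_type, simWeight, mul_smul, Finset.smul_sum]

end simulation

/-! ### The number of remaining positions -/

theorem kept_eq_ceil {α : ℝ} (hα0 : 0 < α) (hα1 : α < 1) (m : ℕ) :
    kept α m = ⌈(1 - α) * m⌉₊ := by
  have hle : ⌊α * m⌋₊ ≤ m := Nat.floor_le_of_le (by nlinarith [(Nat.cast_nonneg m : (0 : ℝ) ≤ m)])
  have h0 : 0 ≤ α * (m : ℝ) := by positivity
  have h1 := Nat.floor_le h0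
  have h2 := Nat.lt_floor_add_one (α * (m : ℝ))
  have hc : ((kept α m : ℕ) : ℝ) = m - ⌊α * (m : ℝ)⌋₊ := by rw [kept, Nat.cast_sub hle]
  symm
  rcases Nat.eq_zero_or_pos (kept α m) with hk | hk
  · rw [hk] at hc ⊢
    push_cast at hc
    rw [Nat.ceil_eq_zero]
    linarith
  · rw [Nat.ceil_eq_iff hk.ne', Nat.cast_sub hk, hc]
    push_cast
    constructor <;> linarith

/-- Rounding the number of tested positions down gives the inequality in the direction needed both
for the storage bound and for bounding `m` linearly by `n`. -/
theorem le_kept {α : ℝ} (hα0 : 0 < α) (hα1 : α < 1) (m : ℕ) : (1 - α) * m ≤ kept α m := by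
  rw [kept_eq_ceil hα0 hα1]
  exact Nat.le_ceil _

theorem kept_lt {α : ℝ} (hα0 : 0 < α) (hα1 : α < 1) (m : ℕ) :
    (kept α m : ℝ) < (1 - α) * m + 1 := by
  rw [kept_eq_ceil hα0 hα1]
  exact Nat.ceil_lt_add_one (by nlinarith [(Nat.cast_nonneg m : (0 : ℝ) ≤ m)])

/-- Finitely many right inverses of `kept α` cover all values of `m`. -/
theorem exists_kept_sections {α : ℝ} (hα0 : 0 < α) (hα1 : α < 1) :
    ∃ (J : ℕ) (s : Fin J → ℕ → ℕ), (∀ j n, kept α (s j n) = n) ∧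
      ∀ m, ∃ j, s j (kept α m) = m := by
  have hβ : 0 < 1 - α := by linarith
  -- `⌊n / (1 - α)⌋₊` is the largest element of the fibre of `kept α` over `n`.
  have hl : ∀ n : ℕ, kept α ⌊(n : ℝ) / (1 - α)⌋₊ = n := fun n => by
    have h1 := Nat.floor_le (by positivity : 0 ≤ (n : ℝ) / (1 - α))
    have h2 := Nat.lt_floor_add_one ((n : ℝ) / (1 - α))
    rw [le_div_iff₀ hβ] at h1
    rw [div_lt_iff₀ hβ] at h2
    have h3 := kept_lt hα0 hα1 ⌊(n : ℝ) / (1 - α)⌋₊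
    have h4 := le_kept hα0 hα1 ⌊(n : ℝ) / (1 - α)⌋₊
    apply le_antisymm
    · have : (kept α ⌊(n : ℝ) / (1 - α)⌋₊ : ℝ) < n + 1 := by nlinarith
      exact Nat.lt_succ_iff.mp (by exact_mod_cast this)
    · have : (n : ℝ) < (kept α ⌊(n : ℝ) / (1 - α)⌋₊ : ℝ) + 1 := by nlinarith
      exact Nat.lt_succ_iff.mp (by exact_mod_cast this)
  -- Every `m` in the fibre satisfies `(n - 1) / (1 - α) < m ≤ n / (1 - α)`, hence lies at most `⌊1
  -- / (1 - α)⌋₊` below the top. The section `j` goes down by `j` from the top, and stays at the top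
  -- if that would leave the fibre.
  refine ⟨⌊1 / (1 - α)⌋₊ + 1, fun j n => if kept α (⌊(n : ℝ) / (1 - α)⌋₊ - j) = n then
    ⌊(n : ℝ) / (1 - α)⌋₊ - j else ⌊(n : ℝ) / (1 - α)⌋₊, fun j n => ?_, fun m => ?_⟩
  · dsimp only
    split_ifs with h
    · exact h
    · exact hl n
  · have hm : m ≤ ⌊(kept α m : ℝ) / (1 - α)⌋₊ :=
      Nat.le_floor (by rw [le_div_iff₀ hβ, mul_comm]; exact le_kept hα0 hα1 m)
    have hj : ⌊(kept α m : ℝ) / (1 - α)⌋₊ - m ≤ ⌊1 / (1 - α)⌋₊ := by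
      refine Nat.le_floor ?_
      rw [Nat.cast_sub hm, le_div_iff₀ hβ]
      have h1 := Nat.floor_le (by positivity : 0 ≤ (kept α m : ℝ) / (1 - α))
      rw [le_div_iff₀ hβ] at h1
      nlinarith [kept_lt hα0 hα1 m]
    refine ⟨⟨⌊(kept α m : ℝ) / (1 - α)⌋₊ - m, Nat.lt_succ_of_le hj⟩, ?_⟩
    dsimp only
    rw [Nat.sub_sub_self hm, if_pos rfl]

theorem Negligible.of_kept {α : ℝ} (hα0 : 0 < α) (hα1 : α < 1) {J : ℕ} {g : Fin J → ℕ → ℝ}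
    (hg : ∀ j, Negligible (g j)) {f : ℕ → ℝ} (hf : ∀ m, ∃ j, f m = g j (kept α m)) :
    Negligible f := by
  have hβ : 0 < 1 - α := by linarith
  have hk : Filter.Tendsto (kept α) Filter.atTop Filter.atTop := by
    exact (tendsto_natCast_atTop_iff (R := ℝ)).mp (Filter.tendsto_atTop_mono (le_kept hα0 hα1)
      (tendsto_natCast_atTop_atTop.const_mul_atTop hβ))
  intro d
  -- The index `j` may change with `m`; the sum over all `j` dominates whichever one occurs. The
  -- factor comes from `m ^ d ≤ (kept α m / (1 - α)) ^ d`.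
  have hlim : Filter.Tendsto (fun m => ∑ j, (1 / (1 - α)) ^ d *
      |(kept α m : ℝ) ^ d * g j (kept α m)|) Filter.atTop (nhds 0) := by
    have : ∀ j, Filter.Tendsto (fun m => (1 / (1 - α)) ^ d *
        |(kept α m : ℝ) ^ d * g j (kept α m)|) Filter.atTop (nhds 0) := fun j => by
      simpa using (((hg j d).comp hk).abs).const_mul ((1 / (1 - α)) ^ d)
    simpa using tendsto_finsetSum Finset.univ fun j _ => this j
  refine squeeze_zero_norm (fun m => ?_) hlim
  obtain ⟨j, hj⟩ := hf m
  change ‖(m : ℝ) ^ d * f m‖ ≤ _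
  refine le_trans ?_ (Finset.single_le_sum (f := fun j => (1 / (1 - α)) ^ d *
    |(kept α m : ℝ) ^ d * g j (kept α m)|) (fun j _ => by positivity) (Finset.mem_univ j))
  rw [Real.norm_eq_abs, hj, abs_mul, abs_mul, ← mul_assoc, abs_pow, abs_pow, Nat.abs_cast,
    Nat.abs_cast, ← mul_pow]
  gcongr
  rw [one_div, inv_mul_eq_div, le_div_iff₀ hβ, mul_comm]
  exact le_kept hα0 hα1 m

/-! ### Security of the compiled protocol -/

/-- The adversary `A` is `simulate` applied to `B m`, with the same input and output registers, so
ideal adversaries and input states carry over literally. Keeping `n` a variable with `kept α m = n`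
avoids transport between types over `kept α (s j n)` and over `n`. -/
theorem exists_simulator {α : ℝ} {U V X Y : ℕ → Type} [∀ n, Fintype (U n)] [∀ n, Fintype (V n)]
    [∀ n, Fintype (X n)] [∀ n, DecidableEq (X n)] [∀ n, Fintype (Y n)]
    (P : ∀ n, Protocol n (U n) (V n) (X n) (Y n)) (F : ∀ n, Functionality (U n) (V n) (X n) (Y n))
    (K : ℕ → CommitmentScheme) (B : ∀ m, RealAdversary (compiled α P K m)) {m n : ℕ}
    (hn : kept α m = n) :
    ∃ A : RealAdversary (P n),
      (∀ k, Fintype.card (A.Q k) = Fintype.card ((B m).Q (k + 2))) ∧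
      ∀ S : IdealAdversary (V n) (Y n) A.Z A.V' A.Y',
        ∃ S' : IdealAdversary (V (kept α m)) (Y (kept α m)) (B m).Z (B m).V' (B m).Y',
          ∀ I : InputState (U (kept α m)) (B m).Z (B m).V', I.IsLegitimate →
            ∃ I' : InputState (U n) A.Z A.V', I'.IsLegitimate ∧
              cqTraceDist (realOut (B m) I) (idealOut (F (kept α m)) S' I)
                = cqTraceDist (realOut A I') (idealOut (F n) S I') := by
  subst hn
  refine ⟨simulate (kept_le α m) (B m), fun k => rfl, fun S => ⟨S, fun I hI => ⟨I, hI, ?_⟩⟩⟩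
  rw [funext (realOut_simulate (kept_le α m) (B m) I)]
  rfl

end BQSM

theorem mainTheorem5 {U V X Y : ℕ → Type} [∀ n, Fintype (U n)] [∀ n, Fintype (V n)]
    [∀ n, Fintype (X n)] [∀ n, DecidableEq (X n)] [∀ n, Fintype (Y n)]
    (P : ∀ n, BQSM.Protocol n (U n) (V n) (X n) (Y n))
    (F : ∀ n, BQSM.Functionality (U n) (V n) (X n) (Y n))
    (K : ℕ → BQSM.CommitmentScheme)
    (α γ : ℝ) (hα0 : 0 < α) (hα1 : α < 1) (hγ0 : 0 < γ) (hγ1 : γ < 1)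
    (p : ℕ → ℕ) (hP : BQSM.BQSMSecure P F γ p) :
    BQSM.BQSMSecure
      (U := fun m => U (BQSM.kept α m)) (V := fun m => V (BQSM.kept α m))
      (X := fun m => X (BQSM.kept α m)) (Y := fun m => Y (BQSM.kept α m))
      (BQSM.compiled α P K) (fun m => F (BQSM.kept α m)) (γ * (1 - α))
      (fun m => p (BQSM.kept α m) + 2) := by
  classical
  intro B hB
  obtain ⟨J, s, hs, hcover⟩ := BQSM.exists_kept_sections hα0 hα1
  choose A hQ hA using fun (j : Fin J) (n : ℕ) => BQSM.exists_simulator P F K B (hs j n)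
  have hbounded : ∀ j, BQSM.IsBoundedStorage γ p (A j) := by
    intro j n k hpk hk
    obtain ⟨q, hq, hcard⟩ := hB (s j n) (k + 2) (by dsimp only; rw [hs]; omega)
      (Nat.add_le_add_right (by rw [hs]; exact hk) 2)
    refine ⟨q, hq.trans ?_, (hQ j n k).trans_le hcard⟩
    have := BQSM.le_kept hα0 hα1 (s j n)
    rw [hs] at this
    rw [mul_assoc]
    exact mul_le_mul_of_nonneg_left this hγ0.le
  choose S hS using fun j => hP (A j) (hbounded j)
  choose S' I' hI' hdist using fun j n => hA j n (S j n)
  choose j hj using hcover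
  -- The ideal adversary for `m` comes from the section through `m`.
  have hT : ∀ m, ∃ T : BQSM.IdealAdversary (V (BQSM.kept α m)) (Y (BQSM.kept α m)) (B m).Z
      (B m).V' (B m).Y', ∀ I : BQSM.InputState (U (BQSM.kept α m)) (B m).Z (B m).V',
      I.IsLegitimate → ∃ I' : BQSM.InputState (U (BQSM.kept α m)) (A (j m) (BQSM.kept α m)).Z
        (A (j m) (BQSM.kept α m)).V', I'.IsLegitimate ∧
          BQSM.cqTraceDist (BQSM.realOut (B m) I) (BQSM.idealOut (F (BQSM.kept α m)) T I)
            = BQSM.cqTraceDist (BQSM.realOut (A (j m) (BQSM.kept α m)) I')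
                (BQSM.idealOut (F (BQSM.kept α m)) (S (j m) (BQSM.kept α m)) I') := by
    -- With `n` and `m` independent, `m` can be eliminated by substitution, which is impossible for
    -- `n = kept α m`.
    have key : ∀ (i : Fin J) (n m : ℕ), s i n = m →
        ∃ T : BQSM.IdealAdversary (V (BQSM.kept α m)) (Y (BQSM.kept α m)) (B m).Z
          (B m).V' (B m).Y', ∀ I : BQSM.InputState (U (BQSM.kept α m)) (B m).Z (B m).V',
          I.IsLegitimate → ∃ I' : BQSM.InputState (U n) (A i n).Z (A i n).V', I'.IsLegitimate ∧
            BQSM.cqTraceDist (BQSM.realOut (B m) I) (BQSM.idealOut (F (BQSM.kept α m)) T I)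
              = BQSM.cqTraceDist (BQSM.realOut (A i n) I') (BQSM.idealOut (F n) (S i n) I') := by
      rintro i n _ rfl
      exact ⟨S' i n, fun I hI => ⟨I' i n I hI, hI' i n I hI, hdist i n I hI⟩⟩
    exact fun m => key _ _ m (hj m)
  choose T hT using hT
  refine ⟨T, fun I hI => ?_⟩
  -- Each family `A i` needs one input state for every `n`. At most one `m` with `kept α m = n` is
  -- assigned to section `i`, namely `s i n`, so there is no conflict.
  have hIn : ∀ (i : Fin J) (n : ℕ), ∃ I₁ : BQSM.InputState (U n) (A i n).Z (A i n).V',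
      I₁.IsLegitimate ∧ ∀ m, BQSM.kept α m = n → j m = i →
        BQSM.cqTraceDist (BQSM.realOut (B m) (I m)) (BQSM.idealOut (F (BQSM.kept α m)) (T m) (I m))
          = BQSM.cqTraceDist (BQSM.realOut (A i n) I₁) (BQSM.idealOut (F n) (S i n) I₁) := by
    intro i n
    by_cases h : ∃ m, BQSM.kept α m = n ∧ j m = i
    · obtain ⟨m, rfl, rfl⟩ := h
      obtain ⟨I₁, h₁, h₂⟩ := hT m (I m) (hI m)
      refine ⟨I₁, h₁, fun m' hm hjm => ?_⟩
      obtain rfl : m' = m := by rw [← hj m', ← hj m, hm, hjm]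
      exact h₂
    -- If no `m` is assigned to the pair, any legitimate state will do.
    · exact ⟨I' i n (I (s i n)) (hI _), hI' i n _ _, fun m hm hjm => (h ⟨m, hm, hjm⟩).elim⟩
  choose I₁ h₁ h₂ using hIn
  exact BQSM.Negligible.of_kept hα0 hα1 (fun i => hS i (I₁ i) (h₁ i))
    fun m => ⟨j m, h₂ (j m) _ m rfl rfl⟩
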